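/- Let $\mathcal X\subset\mathbb R^d$ be a closed set contained in the ball of radius $r$ centered at the origin, let $\mathbb P$ be a probability distribution on $\mathcal X$, and let $\sigma:\mathbb R\to\mathbb R$ be continuous with $|\sigma(z)|\le K|z|^k+M$ for all $z\in\mathbb R$, for some $K,M\ge 0$ and $k\in\mathbb N_0$. Let $\mu$ be a probability distribution on $\mathbb R^{d+1}$ whose support is dense in $\mathbb R^{d+1}$ and which satisfies $\int|\omega|^{2k}\,\mathrm d\mu(\omega)\le M_2<\infty$. Write $\sigma_\omega(x)=\sigma(\omega\cdot(x,1))$ for $x\in\mathcal X$ and $\omega\in\mathbb R^{d+1}$, and let $\Sigma:L^2(\mathbb P)\to L^2(\mathbb P)$ be the integral operator \[ (\Sigma f)(x)=\int k_{\sigma,\mu}(x,y)f(y)\,\mathrm d\mathbb P(y),\qquad k_{\sigma,\mu}(x,y)=\int\sigma_\omega(x)\sigma_\omega(y)\,\mathrm d\mu(\omega). \] Assume that $\sigma$ is not a polynomial and that $(\sigma,\mu)$ is admissible with respect to $\mathbb P$, that is, for every $\lambda>0$, \[ \sup_{\omega\in\mathbb R^{d+1}}\big\langle\sigma_\omega,(\Sigma+\lambda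 I)^{-1}\sigma_\omega\big\rangle_{L^2(\mathbb P)}<\infty. \] Then the random feature $(\sigma,\mu)$ is universal: for every continuous $f:\mathcal X\to\mathbb R$ and all $\delta,\epsilon>0$ there is a positive integer $N$ such that, if $\omega_1,\dots,\omega_N$ are sampled independently from $\mu$, then with probability greater than $1-\delta$ there exist coefficients $c_1,\dots,c_N\in\mathbb R$ with \[ \Big\|\sum_{i=1}^N c_i\,\sigma_{\omega_i}-f\Big\|_{L^2(\mathbb P)}<\epsilon. \] -/

import Mathlib

open MeasureTheory

noncomputable section

namespace RandomFeature

section General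

variable {X Ω : Type*} [MeasurableSpace X] [MeasurableSpace Ω]

/-- The kernel `k(x, y) = ∫ φ(x; ω) φ(y; ω) dμ(ω)` of the random feature `(φ, μ)`. -/
def kernel (φ : X → Ω → ℝ) (μ : Measure Ω) (x y : X) : ℝ :=
  ∫ ω, φ x ω * φ y ω ∂μ

theorem ae_memLp_section {P : Measure X} [IsProbabilityMeasure P] {k : X → X → ℝ}
    (hk : MemLp (Function.uncurry k) 2 (P.prod P)) :
    ∀ᵐ x ∂P, MemLp (k x) 2 P := by
  have h2 := (memLp_two_iff_integrable_sq hk.1).1 hk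
  filter_upwards [h2.prod_right_ae, hk.1.prodMk_left] with x hx hm
  exact (memLp_two_iff_integrable_sq hm).2 hx

theorem integralOp_bound {P : Measure X} [IsProbabilityMeasure P] {k : X → X → ℝ}
    (hk : MemLp (Function.uncurry k) 2 (P.prod P)) (f : Lp ℝ 2 P) :
    eLpNorm (fun x => ∫ y, k x y * f y ∂P) 2 P
      ≤ eLpNorm (Function.uncurry k) 2 (P.prod P) * eLpNorm f 2 P := by
  have key : ∀ᵐ x ∂P, ‖∫ y, k x y * f y ∂P‖ₑ ≤ eLpNorm (k x) 2 P * eLpNorm f 2 P := by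
    filter_upwards [ae_memLp_section hk] with x hx
    refine (enorm_integral_le_lintegral_enorm _).trans ?_
    have h := eLpNorm_smul_le_mul_eLpNorm (p := 2) (q := 2) (r := 1) (μ := P) (φ := k x)
      (f := fun y => f y) (Lp.memLp f).1 hx.1
    rwa [eLpNorm_one_eq_lintegral_enorm] at h
  have hsq : ∀ g : X → ℝ, eLpNorm g 2 P = (∫⁻ a, ‖g a‖ₑ ^ 2 ∂P) ^ (1 / 2 : ℝ) := by
    intro g
    rw [eLpNorm_eq_lintegral_rpow_enorm_toReal (by norm_num) (by norm_num)]
    simp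
  have hsqk : eLpNorm (Function.uncurry k) 2 (P.prod P)
      = (∫⁻ x, eLpNorm (k x) 2 P ^ 2 ∂P) ^ (1 / 2 : ℝ) := by
    rw [eLpNorm_eq_lintegral_rpow_enorm_toReal (by norm_num) (by norm_num)]
    rw [lintegral_prod _ (hk.1.enorm.pow_const _)]
    congr 1
    refine lintegral_congr fun x => ?_
    rw [hsq, ← ENNReal.rpow_natCast, ← ENNReal.rpow_mul]
    simp
  rw [hsq (fun x => ∫ y, k x y * f y ∂P), hsqk]
  calc (∫⁻ x, ‖∫ y, k x y * f y ∂P‖ₑ ^ 2 ∂P) ^ (1 / 2 : ℝ)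
      ≤ (∫⁻ x, eLpNorm (k x) 2 P ^ 2 * eLpNorm f 2 P ^ 2 ∂P) ^ (1 / 2 : ℝ) := by
        refine ENNReal.rpow_le_rpow (lintegral_mono_ae ?_) (by norm_num)
        filter_upwards [key] with x hx
        rw [← mul_pow]
        exact pow_le_pow_left' hx 2
    _ = _ := by
        rw [lintegral_mul_const' _ _ (ENNReal.pow_ne_top (Lp.memLp f).2.ne),
          ENNReal.mul_rpow_of_nonneg _ _ (by norm_num), ← ENNReal.rpow_natCast (eLpNorm f 2 P),
          ← ENNReal.rpow_mul]
        simp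

theorem memLp_integralOp {P : Measure X} [IsProbabilityMeasure P] {k : X → X → ℝ}
    (hk : MemLp (Function.uncurry k) 2 (P.prod P)) (f : Lp ℝ 2 P) :
    MemLp (fun x => ∫ y, k x y * f y ∂P) 2 P := by
  refine ⟨?_, (integralOp_bound hk f).trans_lt (ENNReal.mul_lt_top hk.2 (Lp.memLp f).2)⟩
  exact AEStronglyMeasurable.integral_prod_right' (f := fun z : X × X => k z.1 z.2 * f z.2)
    (hk.1.mul (Lp.memLp f).1.comp_snd)

/-- The integral operator `(Σ f)(x) = ∫ k(x, y) f(y) dP(y)` on `L²(P)`, for a square integrable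
kernel `k`. -/
def integralOp (P : Measure X) [IsProbabilityMeasure P] (k : X → X → ℝ)
    (hk : MemLp (Function.uncurry k) 2 (P.prod P)) : Lp ℝ 2 P →L[ℝ] Lp ℝ 2 P :=
  LinearMap.mkContinuous
    { toFun := fun f => (memLp_integralOp hk f).toLp
      map_add' := by
        intro f g
        rw [← MemLp.toLp_add, MemLp.toLp_eq_toLp_iff]
        filter_upwards [ae_memLp_section hk] with x hx
        have h1 : Integrable (fun y => k x y * f y) P := hx.integrable_mul (Lp.memLp f)
        have h2 : Integrable (fun y => k x y * g y) P := hx.integrable_mul (Lp.memLp g)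
        rw [Pi.add_apply, ← integral_add h1 h2]
        refine integral_congr_ae ?_
        filter_upwards [Lp.coeFn_add f g] with y hy
        rw [hy, Pi.add_apply, mul_add]
      map_smul' := by
        intro c f
        rw [RingHom.id_apply, ← MemLp.toLp_const_smul, MemLp.toLp_eq_toLp_iff]
        filter_upwards with x
        rw [Pi.smul_apply, smul_eq_mul, ← integral_const_mul]
        refine integral_congr_ae ?_
        filter_upwards [Lp.coeFn_smul c f] with y hy
        rw [hy, Pi.smul_apply, smul_eq_mul]
        ring }
    (eLpNorm (Function.uncurry k) 2 (P.prod P)).toReal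
    (by
      intro f
      change ‖(memLp_integralOp hk f).toLp‖ ≤ _
      rw [Lp.norm_toLp, Lp.norm_def, ← ENNReal.toReal_mul]
      exact ENNReal.toReal_mono (ENNReal.mul_lt_top hk.2 (Lp.memLp f).2).ne
        (integralOp_bound hk f))

theorem integralOp_apply (P : Measure X) [IsProbabilityMeasure P] (k : X → X → ℝ)
    (hk : MemLp (Function.uncurry k) 2 (P.prod P)) (f : Lp ℝ 2 P) :
    integralOp P k hk f =ᵐ[P] fun x => ∫ y, k x y * f y ∂P :=
  (memLp_integralOp hk f).coeFn_toLp

/-- The random feature `(φ, μ)`, with all `φ(·; ω)` and its kernel square integrable, is admissible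
with respect to the data distribution `P`: for every `λ > 0`, with `Σ` the integral operator of the
kernel on `L²(P)`, `sup_ω ⟨φ(·; ω), (Σ + λ I)⁻¹ φ(·; ω)⟩ < ∞`. -/
def IsAdmissible (φ : X → Ω → ℝ) (μ : Measure Ω) (P : Measure X) [IsProbabilityMeasure P]
    (hφ : ∀ ω, MemLp (fun x => φ x ω) 2 P)
    (hk : MemLp (Function.uncurry (kernel φ μ)) 2 (P.prod P)) : Prop :=
  ∀ l : ℝ, 0 < l → BddAbove (Set.range fun ω : Ω =>
    inner ℝ ((hφ ω).toLp)
      (Ring.inverse (integralOp P (kernel φ μ) hk + l • (1 : Lp ℝ 2 P →L[ℝ] Lp ℝ 2 P))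
        ((hφ ω).toLp)))

/-- The random feature `(φ, μ)` is universal with respect to `P`: every continuous function is, in
`L²(P)` and up to `ε`, with probability greater than `1 - δ`, a linear combination of `N` features
with independent parameters `ω₁, …, ω_N` of law `μ`. -/
def IsUniversal [TopologicalSpace X] (φ : X → Ω → ℝ) (μ : Measure Ω) [IsProbabilityMeasure μ]
    (P : Measure X) : Prop :=
  ∀ f : C(X, ℝ), ∀ δ : ℝ, 0 < δ → ∀ ε : ℝ, 0 < ε → ∃ N : ℕ, 0 < N ∧
    1 - δ < (Measure.pi fun _ : Fin N => μ).real
      {ω | ∃ c : Fin N → ℝ,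
        eLpNorm (fun x => ∑ i, c i * φ x (ω i) - f x) 2 P < ENNReal.ofReal ε}

end General

section Neuron

variable {d : ℕ}

/-- The concatenation `(x, 1)`. -/
def augment (x : EuclideanSpace ℝ (Fin d)) : EuclideanSpace ℝ (Fin (d + 1)) :=
  WithLp.toLp 2 (Fin.snoc (fun i => x i) 1)

/-- The feature map `φ(x; ω) = σ(ω · (x, 1))` of neural network type, for `x` in `X`. -/
def neuron (σ : ℝ → ℝ) (X : Set (EuclideanSpace ℝ (Fin d))) (x : X)
    (ω : EuclideanSpace ℝ (Fin (d + 1))) : ℝ :=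
  σ (inner ℝ ω (augment (x : EuclideanSpace ℝ (Fin d))))

theorem continuous_augment :
    Continuous (augment : EuclideanSpace ℝ (Fin d) → EuclideanSpace ℝ (Fin (d + 1))) := by
  unfold augment
  refine (PiLp.continuous_toLp 2 _).comp (continuous_pi fun i => ?_)
  refine Fin.lastCases ?_ (fun j => ?_) i
  · simpa using continuous_const
  · simpa using (by fun_prop : Continuous fun x : EuclideanSpace ℝ (Fin d) => x j)

theorem continuous_neuron {σ : ℝ → ℝ} (hσ : Continuous σ)
    (X : Set (EuclideanSpace ℝ (Fin d))) : Continuous (Function.uncurry (neuron σ X)) := by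
  have := continuous_augment (d := d)
  unfold neuron Function.uncurry
  fun_prop

theorem norm_augment_le {r : ℝ} {x : EuclideanSpace ℝ (Fin d)} (hx : x ∈ Metric.closedBall 0 r) :
    ‖augment x‖ ^ 2 ≤ r ^ 2 + 1 := by
  have h1 : ‖augment x‖ ^ 2 = ‖x‖ ^ 2 + 1 := by
    rw [EuclideanSpace.norm_sq_eq, EuclideanSpace.norm_sq_eq, Fin.sum_univ_castSucc]
    simp [augment]
  have h2 : ‖x‖ ≤ r := by simpa using hx
  rw [h1]
  gcongr

theorem neuron_sq_le {σ : ℝ → ℝ} {K M r : ℝ} {k : ℕ}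
    (hgrowth : ∀ z, |σ z| ≤ K * |z| ^ k + M) {X : Set (EuclideanSpace ℝ (Fin d))}
    (hXr : X ⊆ Metric.closedBall 0 r) (x : X) (ω : EuclideanSpace ℝ (Fin (d + 1))) :
    neuron σ X x ω ^ 2 ≤ 2 * (K ^ 2 * (r ^ 2 + 1) ^ k) * ‖ω‖ ^ (2 * k) + 2 * M ^ 2 := by
  have h1 := hgrowth (inner ℝ ω (augment (x : EuclideanSpace ℝ (Fin d))))
  have h2 := abs_real_inner_le_norm ω (augment (x : EuclideanSpace ℝ (Fin d)))
  have h3 := norm_augment_le (hXr x.2)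
  set z := inner ℝ ω (augment (x : EuclideanSpace ℝ (Fin d)))
  have h4 : (|z| ^ k) ^ 2 ≤ (r ^ 2 + 1) ^ k * ‖ω‖ ^ (2 * k) := by
    calc (|z| ^ k) ^ 2 = (|z| ^ 2) ^ k := by ring
      _ ≤ ((‖ω‖ * ‖augment (x : EuclideanSpace ℝ (Fin d))‖) ^ 2) ^ k := by gcongr
      _ = (‖augment (x : EuclideanSpace ℝ (Fin d))‖ ^ 2) ^ k * ‖ω‖ ^ (2 * k) := by ring
      _ ≤ _ := by gcongr
  have h5 : |σ z| ^ 2 ≤ (K * |z| ^ k + M) ^ 2 := by gcongr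
  have h6 := mul_le_mul_of_nonneg_left h4 (sq_nonneg K)
  calc neuron σ X x ω ^ 2 = |σ z| ^ 2 := by rw [sq_abs]; rfl
    _ ≤ 2 * (K ^ 2 * (|z| ^ k) ^ 2) + 2 * M ^ 2 := by
        nlinarith [sq_nonneg (K * |z| ^ k - M)]
    _ ≤ _ := by linarith

theorem memLp_neuron {σ : ℝ → ℝ} (hσ : Continuous σ) {X : Set (EuclideanSpace ℝ (Fin d))} {r : ℝ}
    (hX : IsClosed X) (hXr : X ⊆ Metric.closedBall 0 r) (P : Measure X) [IsProbabilityMeasure P]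
    (ω : EuclideanSpace ℝ (Fin (d + 1))) : MemLp (fun x => neuron σ X x ω) 2 P := by
  have : CompactSpace X := isCompact_iff_compactSpace.1
    ((isCompact_closedBall 0 r).of_isClosed_subset hX hXr)
  have hc : Continuous fun x => neuron σ X x ω :=
    (continuous_neuron hσ X).comp (by fun_prop : Continuous fun x : X => (x, ω))
  obtain ⟨C, hC⟩ := isCompact_univ.exists_bound_of_continuousOn hc.continuousOn
  exact MemLp.of_bound hc.aestronglyMeasurable C (.of_forall fun x => hC x trivial)

theorem abs_neuron_mul_le {σ : ℝ → ℝ} {K M r : ℝ} {k : ℕ}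
    (hgrowth : ∀ z, |σ z| ≤ K * |z| ^ k + M) {X : Set (EuclideanSpace ℝ (Fin d))}
    (hXr : X ⊆ Metric.closedBall 0 r) (x y : X) (ω : EuclideanSpace ℝ (Fin (d + 1))) :
    ‖neuron σ X x ω * neuron σ X y ω‖
      ≤ 2 * (K ^ 2 * (r ^ 2 + 1) ^ k) * ‖ω‖ ^ (2 * k) + 2 * M ^ 2 := by
  have hx := neuron_sq_le hgrowth hXr x ω
  have hy := neuron_sq_le hgrowth hXr y ω
  rw [Real.norm_eq_abs, abs_mul]
  nlinarith [sq_nonneg (|neuron σ X x ω| - |neuron σ X y ω|), sq_abs (neuron σ X x ω),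
    sq_abs (neuron σ X y ω)]

theorem memLp_kernel {σ : ℝ → ℝ} (hσ : Continuous σ) {K M r : ℝ} {k : ℕ}
    (hgrowth : ∀ z, |σ z| ≤ K * |z| ^ k + M) {X : Set (EuclideanSpace ℝ (Fin d))}
    (hXr : X ⊆ Metric.closedBall 0 r)
    {μ : Measure (EuclideanSpace ℝ (Fin (d + 1)))} [IsProbabilityMeasure μ]
    (hmom : Integrable (fun ω => ‖ω‖ ^ (2 * k)) μ) (P : Measure X) [IsProbabilityMeasure P] :
    MemLp (Function.uncurry (kernel (neuron σ X) μ)) 2 (P.prod P) := by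
  have hc := continuous_neuron hσ X
  have hcc : Continuous fun p : (X × X) × EuclideanSpace ℝ (Fin (d + 1)) =>
      neuron σ X p.1.1 p.2 * neuron σ X p.1.2 p.2 :=
    (hc.comp (by fun_prop : Continuous fun p : (X × X) × EuclideanSpace ℝ (Fin (d + 1)) =>
      (p.1.1, p.2))).mul
    (hc.comp (by fun_prop : Continuous fun p : (X × X) × EuclideanSpace ℝ (Fin (d + 1)) =>
      (p.1.2, p.2)))
  refine MemLp.of_bound (StronglyMeasurable.integral_prod_right'
      (f := fun p : (X × X) × EuclideanSpace ℝ (Fin (d + 1)) =>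
        neuron σ X p.1.1 p.2 * neuron σ X p.1.2 p.2) hcc.stronglyMeasurable).aestronglyMeasurable
    (∫ ω, 2 * (K ^ 2 * (r ^ 2 + 1) ^ k) * ‖ω‖ ^ (2 * k) + 2 * M ^ 2 ∂μ)
    (.of_forall fun p => ?_)
  exact norm_integral_le_of_norm_le ((hmom.const_mul _).add (integrable_const _))
    (.of_forall fun ω => abs_neuron_mul_le hgrowth hXr p.1 p.2 ω)

/-- The kernel operator is positive, so that `Σ + λ I` is invertible for `λ > 0`. -/
theorem isUnit_integralOp_add {σ : ℝ → ℝ} (hσ : Continuous σ) {K M r : ℝ} {k : ℕ}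
    (hgrowth : ∀ z, |σ z| ≤ K * |z| ^ k + M) {X : Set (EuclideanSpace ℝ (Fin d))}
    (hXr : X ⊆ Metric.closedBall 0 r)
    {μ : Measure (EuclideanSpace ℝ (Fin (d + 1)))} [IsProbabilityMeasure μ]
    (hmom : Integrable (fun ω => ‖ω‖ ^ (2 * k)) μ) (P : Measure X) [IsProbabilityMeasure P]
    {l : ℝ} (hl : 0 < l) :
    IsUnit (integralOp P (kernel (neuron σ X) μ) (memLp_kernel hσ hgrowth hXr hmom P)
      + l • (1 : Lp ℝ 2 P →L[ℝ] Lp ℝ 2 P)) := by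
  set S := integralOp P (kernel (neuron σ X) μ) (memLp_kernel hσ hgrowth hXr hmom P) with hS
  have hpos : ∀ f : Lp ℝ 2 P, 0 ≤ inner ℝ (S f) f := by
    intro f
    have hf : Integrable f P := (Lp.memLp f).integrable (by norm_num)
    have hc := continuous_neuron hσ X
    set F : (X × X) × EuclideanSpace ℝ (Fin (d + 1)) → ℝ := fun p =>
      (f p.1.1 * f p.1.2) * (neuron σ X p.1.1 p.2 * neuron σ X p.1.2 p.2) with hF
    have hcc : Continuous fun p : (X × X) × EuclideanSpace ℝ (Fin (d + 1)) =>
        neuron σ X p.1.1 p.2 * neuron σ X p.1.2 p.2 :=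
      (hc.comp (by fun_prop : Continuous fun p : (X × X) × EuclideanSpace ℝ (Fin (d + 1)) =>
        (p.1.1, p.2))).mul
      (hc.comp (by fun_prop : Continuous fun p : (X × X) × EuclideanSpace ℝ (Fin (d + 1)) =>
        (p.1.2, p.2)))
    have hff : Integrable (fun p : X × X => f p.1 * f p.2) (P.prod P) := hf.mul_prod hf
    have hFi : Integrable F ((P.prod P).prod μ) := by
      refine Integrable.mono' (hff.norm.mul_prod
        ((hmom.const_mul (2 * (K ^ 2 * (r ^ 2 + 1) ^ k))).add (integrable_const (2 * M ^ 2))))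
        (hff.1.comp_fst.mul hcc.aestronglyMeasurable) (.of_forall fun p => ?_)
      rw [hF, norm_mul]
      exact mul_le_mul_of_nonneg_left (abs_neuron_mul_le hgrowth hXr _ _ _) (norm_nonneg _)
    have e1 : inner ℝ (S f) f
        = ∫ x, ∫ y, ∫ ω, F ((x, y), ω) ∂μ ∂P ∂P := by
      rw [L2.inner_def]
      refine integral_congr_ae ?_
      filter_upwards [integralOp_apply P _ (memLp_kernel hσ hgrowth hXr hmom P) f] with x hx
      rw [hS, hx]
      simp only [RCLike.inner_apply, conj_trivial]
      rw [← integral_const_mul]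
      refine integral_congr_ae (.of_forall fun y => ?_)
      simp only [hF, kernel]
      rw [integral_const_mul]
      ring
    have e2 : ∫ x, ∫ y, ∫ ω, F ((x, y), ω) ∂μ ∂P ∂P
        = ∫ ω, (∫ x, f x * neuron σ X x ω ∂P) ^ 2 ∂μ := by
      rw [← integral_prod (fun p : X × X => ∫ ω, F (p, ω) ∂μ) hFi.integral_prod_left,
        integral_integral_swap hFi]
      refine integral_congr_ae (.of_forall fun ω => ?_)
      simp only [hF]
      rw [sq, ← integral_prod_mul]
      refine integral_congr_ae (.of_forall fun p => ?_)
      ring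
    rw [e1, e2]
    exact integral_nonneg fun ω => sq_nonneg _
  refine ContinuousLinearMap.isUnit_of_forall_le_norm_inner_map _ (c := ⟨l, hl.le⟩) hl fun f => ?_
  change ‖f‖ ^ 2 * l ≤ _
  have e : inner ℝ ((S + l • (1 : Lp ℝ 2 P →L[ℝ] Lp ℝ 2 P)) f) f
      = inner ℝ (S f) f + l * ‖f‖ ^ 2 := by
    simp [inner_add_left, inner_smul_left]
  rw [e, Real.norm_eq_abs]
  refine le_trans ?_ (le_abs_self _)
  linarith [hpos f]

end Neuron

end RandomFeature

end

/-! The span of all neurons is dense in `L²(P)`, and random sampling only has to imitate one good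
finite combination. Density is by duality. Let `h` be orthogonal to every neuron and let `u(x) = w ·
x`, so that `h` annihilates every `σ(s u + b)`. Mollifying `σ` gives a smooth `g` with the same
property. Differentiating `n` times in `s` and setting `s = 0` leaves `g⁽ⁿ⁾(b) ∫ h uⁿ dP = 0`. As
`σ` is not a polynomial, for each `n` some mollification has `g⁽ⁿ⁾(b) ≠ 0`, so all moments `∫ h uⁿ
dP` vanish (`integral_mul_pow_eq_zero`). Summing the exponential series, `h` annihilates each `exp(w
· x)`; these span a dense subspace of `C(X)` by Stone–Weierstrass, hence `h = 0`. For the sampling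
(`exists_sample_norm_lt`), a finite combination of neurons close to the target stays close when its
parameters move within small open sets. These have positive measure because the support of `μ` is
dense, so many independent samples hit all of them with high probability. -/

namespace RandomFeature

open Filter Topology
open scoped ContDiff Convolution

/-! ### Polynomials: vanishing derivatives, pointwise limits, mollification -/

section Polynomial

/-- A smooth function with vanishing `n`-th derivative is a polynomial of degree less than `n`. -/
theorem exists_eq_sum_pow_of_iteratedDeriv_eq_zero (n : ℕ) (f : ℝ → ℝ) (hf : ContDiff ℝ ∞ f)
    (h : ∀ x, iteratedDeriv n f x = 0) :
    ∃ a : ℕ → ℝ, ∀ x, f x = ∑ i ∈ Finset.range n, a i * x ^ i := by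
  induction n generalizing f with
  | zero => exact ⟨0, fun x => by simpa using h x⟩
  | succ n ih =>
    have hd : ContDiff ℝ ∞ (deriv f) := (contDiff_infty_iff_deriv.1 hf).2
    obtain ⟨a, ha⟩ := ih (deriv f) hd fun x => by rw [← iteratedDeriv_succ', h x]
    set q : ℝ → ℝ := fun x => ∑ i ∈ Finset.range n, a i / (i + 1) * x ^ (i + 1) with hq
    have hqd : ∀ x, HasDerivAt q (deriv f x) x := by
      intro x
      rw [ha x]
      refine HasDerivAt.fun_sum fun i _ => ?_
      convert! (hasDerivAt_pow (i + 1) x).const_mul (a i / (i + 1)) using 1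
      have : (i : ℝ) + 1 ≠ 0 := by positivity
      push_cast
      field_simp
    have hfd : Differentiable ℝ f := hf.differentiable (by simp)
    have hc : ∀ x, f x - q x = f 0 - q 0 := fun x =>
      is_const_of_deriv_eq_zero (f := fun y => f y - q y)
        (fun y => ((hfd y).hasDerivAt.sub (hqd y)).differentiableAt)
        (fun y => ((hfd y).hasDerivAt.sub (hqd y)).deriv.trans (sub_self _)) x 0
    refine ⟨fun i => i.casesOn (f 0) fun j => a j / (j + 1), fun x => ?_⟩
    have hq0 : q 0 = 0 := by simp [hq]
    rw [Finset.sum_range_succ']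
    have := hc x
    rw [hq0] at this
    change f x = q x + f 0 * x ^ 0
    rw [pow_zero]
    linarith

/-- A pointwise limit of polynomials of degree less than `n` is a polynomial. -/
theorem exists_polynomial_of_tendsto {ι : Type*} {l : Filter ι} [l.NeBot] {n : ℕ}
    (p : ι → Polynomial ℝ) (hp : ∀ i, (p i).degree < n) (f : ℝ → ℝ)
    (h : ∀ x, Tendsto (fun i => (p i).eval x) l (𝓝 (f x))) :
    ∃ q : Polynomial ℝ, ∀ x, f x = q.eval x := by
  -- A polynomial of degree below `n` is a fixed linear expression in its values at the nodes `0, …,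
  -- n - 1`, so convergence at the nodes identifies the limit.
  have hinj : Set.InjOn (fun j : ℕ => (j : ℝ)) (Finset.range n) := Nat.cast_injective.injOn
  refine ⟨Lagrange.interpolate (Finset.range n) (fun j : ℕ => (j : ℝ)) (fun j => f j), fun x => ?_⟩
  refine tendsto_nhds_unique (h x) ?_
  have : ∀ i, (p i).eval x = ∑ j ∈ Finset.range n, (p i).eval (j : ℝ) *
      (Lagrange.basis (Finset.range n) (fun j : ℕ => (j : ℝ)) j).eval x := by
    intro i
    conv_lhs => rw [Lagrange.eq_interpolate hinj (f := p i) (by simpa using hp i)]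
    simp [Lagrange.interpolate_apply, Polynomial.eval_finsetSum]
  simp_rw [this]
  rw [Lagrange.interpolate_apply, Polynomial.eval_finsetSum]
  simp only [Polynomial.eval_mul, Polynomial.eval_C]
  exact tendsto_finsetSum _ fun j _ => (h j).mul_const _

/-- If the `n`-th derivatives of all mollifications of a continuous function vanish, then the
function is a polynomial. -/
theorem exists_polynomial_of_iteratedDeriv_convolution_eq_zero {σ : ℝ → ℝ} (hσ : Continuous σ)
    (n : ℕ) (h : ∀ (φ : ContDiffBump (0 : ℝ)) (x : ℝ), iteratedDeriv n
      (φ.normed volume ⋆[ContinuousLinearMap.lsmul ℝ ℝ, volume] σ) x = 0) :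
    ∃ p : Polynomial ℝ, ∀ z, σ z = p.eval z := by
  let φ : ℕ → ContDiffBump (0 : ℝ) := fun m =>
    ⟨1 / ((m : ℝ) + 1) / 2, 1 / ((m : ℝ) + 1), by positivity, half_lt_self (by positivity)⟩
  have hφ : Tendsto (fun m => (φ m).rOut) atTop (𝓝 0) := tendsto_one_div_add_atTop_nhds_zero_nat
  have hsm : ∀ m, ContDiff ℝ ∞
      ((φ m).normed volume ⋆[ContinuousLinearMap.lsmul ℝ ℝ, volume] σ) := fun m =>
    (φ m).hasCompactSupport_normed.contDiff_convolution_left _ (φ m).contDiff_normed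
      hσ.locallyIntegrable
  -- The degree bound is the same for all `m`; without this a pointwise limit of polynomials need
  -- not be a polynomial.
  choose a ha using fun m => exists_eq_sum_pow_of_iteratedDeriv_eq_zero n _ (hsm m) (h (φ m))
  refine exists_polynomial_of_tendsto (l := atTop) (n := n)
    (fun m => ∑ i : Fin n, Polynomial.C (a m i) * Polynomial.X ^ (i : ℕ))
    (fun m => Polynomial.degree_sum_fin_lt _) σ fun x => ?_
  have := ContDiffBump.convolution_tendsto_right_of_continuous (μ := volume) hφ hσ x
  refine this.congr fun m => ?_
  rw [ha, Polynomial.eval_finsetSum, Finset.sum_range]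
  simp

end Polynomial

/-! ### Functions annihilating all `σ(s u + b)` -/

section Annihilator

variable {Y : Type*} [TopologicalSpace Y] [CompactSpace Y] [MeasurableSpace Y]
  [OpensMeasurableSpace Y] {P : Measure Y}

theorem integrable_mul_continuous {h : Y → ℝ} (hh : Integrable h P) {u : Y → ℝ}
    (hu : Continuous u) : Integrable (fun y => h y * u y) P := by
  obtain ⟨C, hC⟩ := isCompact_univ.exists_bound_of_continuousOn hu.continuousOn
  exact hh.mul_bdd hu.aestronglyMeasurable (.of_forall fun y => hC y trivial)

/-- Differentiation in the scale of the relation `∫ h(y) g(s u(y) + b) dP(y) = 0`. -/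
theorem integral_mul_iteratedDeriv_eq_zero {h : Y → ℝ} (hh : Integrable h P) {u : Y → ℝ}
    (hu : Continuous u) {g : ℝ → ℝ} (hg : ContDiff ℝ ∞ g)
    (h0 : ∀ s b, ∫ y, h y * g (s * u y + b) ∂P = 0) (n : ℕ) (s b : ℝ) :
    ∫ y, h y * (u y ^ n * iteratedDeriv n g (s * u y + b)) ∂P = 0 := by
  induction n generalizing s with
  | zero => simpa using h0 s b
  | succ n ih =>
    have hc : ∀ m, Continuous (iteratedDeriv m g) := fun m =>
      hg.continuous_iteratedDeriv m (by exact_mod_cast le_top)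
    have hd : Differentiable ℝ (iteratedDeriv n g) :=
      hg.differentiable_iteratedDeriv n (by exact_mod_cast WithTop.coe_lt_top _)
    have hcont : ∀ m, Continuous fun q : ℝ × Y => u q.2 ^ m * iteratedDeriv m g (q.1 * u q.2 + b) :=
      fun m => by have := hc m; fun_prop
    -- Compactness of `Y` and of an interval around `s` gives a uniform bound `C`, hence the
    -- integrable majorant `‖h‖ * C` for the derivative.
    obtain ⟨C, hC⟩ := ((isCompact_Icc (a := s - 1) (b := s + 1)).prod
      (isCompact_univ (X := Y))).exists_bound_of_continuousOn (hcont (n + 1)).continuousOn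
    have hslice : ∀ m t, Continuous fun y => u y ^ m * iteratedDeriv m g (t * u y + b) :=
      fun m t => (hcont m).comp (by fun_prop : Continuous fun y : Y => (t, y))
    have key := hasDerivAt_integral_of_dominated_loc_of_deriv_le (μ := P) (x₀ := s)
      (s := Set.Icc (s - 1) (s + 1))
      (F := fun t y => h y * (u y ^ n * iteratedDeriv n g (t * u y + b)))
      (F' := fun t y => h y * (u y ^ (n + 1) * iteratedDeriv (n + 1) g (t * u y + b)))
      (bound := fun y => ‖h y‖ * C)
      (Icc_mem_nhds (by linarith) (by linarith))
      (.of_forall fun t => (integrable_mul_continuous hh (hslice n t)).1)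
      (integrable_mul_continuous hh (hslice n s))
      (integrable_mul_continuous hh (hslice (n + 1) s)).1
      (.of_forall fun y t ht => by
        rw [norm_mul]
        exact mul_le_mul_of_nonneg_left (hC (t, y) ⟨ht, trivial⟩) (norm_nonneg _))
      (hh.norm.mul_const _)
      (.of_forall fun y t _ => by
        have h1 : HasDerivAt (fun t => t * u y + b) (u y) t := by
          simpa using ((hasDerivAt_id t).mul_const (u y)).add_const b
        have h2 := ((hd (t * u y + b)).hasDerivAt.comp t h1).const_mul (u y ^ n)
        convert! h2.const_mul (h y) using 1
        rw [iteratedDeriv_succ]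
        ring)
    have hz := key.2
    simp only [ih] at hz
    exact hz.unique (hasDerivAt_const s 0)

/-- The relation `∫ h(y) σ(s u(y) + b) dP(y) = 0` passes to mollifications of `σ`. -/
theorem integral_mul_convolution_eq_zero [SFinite P] {h : Y → ℝ} (hh : Integrable h P)
    {u : Y → ℝ} (hu : Continuous u) {σ : ℝ → ℝ} (hσ : Continuous σ)
    (h0 : ∀ s b, ∫ y, h y * σ (s * u y + b) ∂P = 0) (φ : ContDiffBump (0 : ℝ)) (s b : ℝ) :
    ∫ y, h y * (φ.normed volume ⋆[ContinuousLinearMap.lsmul ℝ ℝ, volume] σ) (s * u y + b) ∂P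
      = 0 := by
  have hφc : Continuous (φ.normed volume) := φ.continuous_normed
  have hcont : Continuous fun q : Y × ℝ => σ (s * u q.1 + b - q.2) := by fun_prop
  obtain ⟨C, hC⟩ := ((isCompact_univ (X := Y)).prod
    (isCompact_closedBall (0 : ℝ) φ.rOut)).exists_bound_of_continuousOn hcont.continuousOn
  have hint : Integrable (fun q : Y × ℝ => h q.1 * (φ.normed volume q.2 * σ (s * u q.1 + b - q.2)))
      (P.prod volume) := by
    have hprod : Integrable (fun q : Y × ℝ => h q.1 * φ.normed volume q.2) (P.prod volume) :=
      hh.mul_prod φ.integrable_normed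
    refine Integrable.mono' (hprod.norm.mul_const C) ?_ (.of_forall fun q => ?_)
    · refine hh.1.comp_fst.mul ?_
      have h1 : Measurable fun q : Y × ℝ => φ.normed volume q.2 :=
        hφc.measurable.comp measurable_snd
      have h2 : Measurable fun q : Y × ℝ => σ (s * u q.1 + b - q.2) :=
        hσ.measurable.comp
          ((((hu.measurable.comp measurable_fst).const_mul s).add_const b).sub measurable_snd)
      exact (h1.mul h2).aestronglyMeasurable
    · rw [← mul_assoc, norm_mul]
      -- The factor `σ` is bounded by `C` only over the support of the bump; elsewhere the integrand
      -- is zero.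
      by_cases hq : q.2 ∈ Metric.closedBall (0 : ℝ) φ.rOut
      · exact mul_le_mul_of_nonneg_left (hC q ⟨trivial, hq⟩) (norm_nonneg _)
      · have : φ.normed volume q.2 = 0 := by
          rw [← φ.tsupport_normed_eq (μ := volume)] at hq
          exact image_eq_zero_of_notMem_tsupport hq
        simp [this]
  simp only [convolution_def, ContinuousLinearMap.lsmul_apply, smul_eq_mul]
  simp_rw [← integral_const_mul]
  rw [integral_integral_swap hint]
  refine integral_eq_zero_of_ae (.of_forall fun t => ?_)
  -- The translation by `t` is absorbed in the bias, where the hypothesis applies again.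
  have : ∀ y, h y * (φ.normed volume t * σ (s * u y + b - t))
      = φ.normed volume t * (h y * σ (s * u y + (b - t))) := fun y => by
    rw [add_sub_assoc]; ring
  simp only [this, Pi.zero_apply]
  rw [integral_const_mul, h0, mul_zero]

/-- An integrable `h` which annihilates all `σ(s u + b)`, with `σ` not a polynomial, annihilates
the powers of `u`. -/
theorem integral_mul_pow_eq_zero [SFinite P] {h : Y → ℝ} (hh : Integrable h P) {u : Y → ℝ}
    (hu : Continuous u) {σ : ℝ → ℝ} (hσ : Continuous σ)
    (hpoly : ¬ ∃ p : Polynomial ℝ, ∀ z, σ z = p.eval z)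
    (h0 : ∀ s b, ∫ y, h y * σ (s * u y + b) ∂P = 0) (n : ℕ) :
    ∫ y, h y * u y ^ n ∂P = 0 := by
  obtain ⟨φ, b, hb⟩ : ∃ (φ : ContDiffBump (0 : ℝ)) (b : ℝ), iteratedDeriv n
      (φ.normed volume ⋆[ContinuousLinearMap.lsmul ℝ ℝ, volume] σ) b ≠ 0 := by
    by_contra! hcon
    exact hpoly (exists_polynomial_of_iteratedDeriv_convolution_eq_zero hσ n hcon)
  -- At scale `0` the derivative is evaluated at the constant `b` and leaves the integral.
  have := integral_mul_iteratedDeriv_eq_zero hh hu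
    (φ.hasCompactSupport_normed.contDiff_convolution_left _ φ.contDiff_normed hσ.locallyIntegrable)
    (integral_mul_convolution_eq_zero hh hu hσ h0 φ) n 0 b
  simp only [zero_mul, zero_add, ← mul_assoc] at this
  rw [integral_mul_const] at this
  exact (mul_eq_zero.1 this).resolve_right hb

/-- The exponential series can be integrated term by term: with `|u| ≤ C` its terms are dominated by
`‖h‖ Cⁿ / n!`, whose sum is `‖h‖ exp C`. -/
theorem integral_mul_exp_eq_zero {h : Y → ℝ} (hh : Integrable h P) {u : Y → ℝ}
    (hu : Continuous u) (h0 : ∀ n : ℕ, ∫ y, h y * u y ^ n ∂P = 0) :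
    ∫ y, h y * Real.exp (u y) ∂P = 0 := by
  obtain ⟨C, hC⟩ := isCompact_univ.exists_bound_of_continuousOn hu.continuousOn
  have hexp : ∀ x : ℝ, HasSum (fun n : ℕ => x ^ n / n.factorial) (Real.exp x) := fun x => by
    rw [Real.exp_eq_exp_ℝ]; exact NormedSpace.expSeries_div_hasSum_exp x
  have hs := hasSum_integral_of_dominated_convergence (μ := P)
    (F := fun (n : ℕ) y => h y * (u y ^ n / n.factorial)) (f := fun y => h y * Real.exp (u y))
    (fun n y => ‖h y‖ * (C ^ n / n.factorial))
    (fun n => (integrable_mul_continuous hh (by fun_prop)).1)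
    (fun n => .of_forall fun y => by
      rw [norm_mul, norm_div, norm_pow, RCLike.norm_natCast]
      gcongr
      exact hC y trivial)
    (.of_forall fun y => (hexp C).summable.mul_left _)
    (by
      simp_rw [tsum_mul_left]
      exact hh.norm.mul_const _)
    (.of_forall fun y => (hexp (u y)).mul_left _)
  have hz : ∀ n : ℕ, ∫ y, h y * (u y ^ n / n.factorial) ∂P = 0 := fun n => by
    simp_rw [← mul_div_assoc]
    rw [integral_div, h0, zero_div]
  simp only [hz] at hs
  exact hs.unique hasSum_zero

end Annihilator

end RandomFeature

namespace RandomFeature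

open Filter Topology

/-! ### Density of exponentials in `C(X)` and of neurons in `L²(P)` -/

section Density

variable {d : ℕ} {X : Set (EuclideanSpace ℝ (Fin d))}

/-- The function `x ↦ exp(w · x)` on `X`. -/
noncomputable def expRidge (X : Set (EuclideanSpace ℝ (Fin d))) (w : EuclideanSpace ℝ (Fin d)) :
    C(X, ℝ) :=
  ⟨fun x => Real.exp (inner ℝ w (x : EuclideanSpace ℝ (Fin d))), by fun_prop⟩

/-- Products of exponentials are exponentials and `1` is one of them, so their span is already the
algebra they generate, and Stone–Weierstrass applies. -/
theorem topologicalClosure_span_expRidge [CompactSpace X] :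
    (Submodule.span ℝ (Set.range (expRidge X))).topologicalClosure = ⊤ := by
  have hclosure : (Submonoid.closure (Set.range (expRidge X)) : Set C(X, ℝ))
      ⊆ Submodule.span ℝ (Set.range (expRidge X)) := by
    refine subset_trans (fun f hf => ?_) Submodule.subset_span
    induction hf using Submonoid.closure_induction with
    | mem f hf => exact hf
    | one => exact ⟨0, by ext; simp [expRidge]⟩
    | mul f g _ _ hf hg =>
      obtain ⟨v, rfl⟩ := hf
      obtain ⟨w, rfl⟩ := hg
      exact ⟨v + w, by ext; simp [expRidge, inner_add_left, Real.exp_add]⟩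
  have hsep : (Algebra.adjoin ℝ (Set.range (expRidge X))).SeparatesPoints := by
    intro x y hxy
    -- The direction `x - y` separates `x` from `y`: equal values would force `‖x - y‖² = 0`.
    refine ⟨_, ⟨expRidge X (x - y), Algebra.subset_adjoin ⟨_, rfl⟩, rfl⟩, fun heq => hxy ?_⟩
    have h1 : inner ℝ ((x : EuclideanSpace ℝ (Fin d)) - y) (x : EuclideanSpace ℝ (Fin d))
        = inner ℝ ((x : EuclideanSpace ℝ (Fin d)) - y) (y : EuclideanSpace ℝ (Fin d)) :=
      Real.exp_injective heq
    rw [← sub_eq_zero, ← inner_sub_right, inner_self_eq_zero, sub_eq_zero] at h1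
    exact Subtype.ext h1
  have hsw := ContinuousMap.subalgebra_topologicalClosure_eq_top_of_separatesPoints _ hsep
  rw [← Algebra.adjoin_eq_span_of_subset ℝ hclosure]
  have := congrArg Subalgebra.toSubmodule hsw
  rwa [Algebra.top_toSubmodule] at this

/-- Pairing with `h` is a continuous functional on `C(X)`. It vanishes on a dense span, hence on all
of `C(X)`, whose image is dense in `L²(P)`. -/
theorem eq_zero_of_integral_mul_expRidge_eq_zero [CompactSpace X] (P : Measure X)
    [IsProbabilityMeasure P] (h : Lp ℝ 2 P) (h0 : ∀ w, ∫ x, h x * expRidge X w x ∂P = 0) :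
    h = 0 := by
  let T : C(X, ℝ) →L[ℝ] ℝ := (innerSL ℝ h).comp (ContinuousMap.toLp 2 P ℝ)
  have hT : ∀ f : C(X, ℝ), T f = ∫ x, h x * f x ∂P := fun f => by
    change inner ℝ h (ContinuousMap.toLp 2 P ℝ f) = _
    rw [L2.inner_def]
    refine integral_congr_ae ?_
    filter_upwards [ContinuousMap.coeFn_toLp (p := 2) (𝕜 := ℝ) P f] with x hx
    rw [hx]
    simp [mul_comm]
  have hker : (Submodule.span ℝ (Set.range (expRidge X))).topologicalClosure
      ≤ LinearMap.ker (T : C(X, ℝ) →ₗ[ℝ] ℝ) := by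
    refine Submodule.topologicalClosure_minimal _ (Submodule.span_le.2 ?_) T.isClosed_ker
    rintro _ ⟨w, rfl⟩
    exact (hT _).trans (h0 w)
  rw [topologicalClosure_span_expRidge] at hker
  refine (ContinuousMap.toLp_denseRange (p := 2) ℝ P ℝ (by norm_num)).eq_zero_of_inner_left ℝ ?_
  exact fun f => hker (Submodule.mem_top (x := f))

/-- The map `ω ↦ σ(ω · (x, 1))` into the continuous functions on `X`. -/
noncomputable def neuronMap {σ : ℝ → ℝ} (hσ : Continuous σ)
    (X : Set (EuclideanSpace ℝ (Fin d))) : C(EuclideanSpace ℝ (Fin (d + 1)), C(X, ℝ)) :=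
  ContinuousMap.curry ⟨fun q => neuron σ X q.2 q.1, (continuous_neuron hσ X).comp continuous_swap⟩

theorem neuronMap_apply {σ : ℝ → ℝ} (hσ : Continuous σ) (ω : EuclideanSpace ℝ (Fin (d + 1)))
    (x : X) : neuronMap hσ X ω x = neuron σ X x ω := rfl

theorem inner_snoc_augment (w x : EuclideanSpace ℝ (Fin d)) (s b : ℝ) :
    inner ℝ (WithLp.toLp 2 (Fin.snoc (fun i => s * w i) b) : EuclideanSpace ℝ (Fin (d + 1)))
      (augment x) = s * inner ℝ w x + b := by
  simp [augment, PiLp.inner_apply, Fin.sum_univ_castSucc, Finset.mul_sum, mul_left_comm]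

/-- The neurons with continuous activation function, not a polynomial, span a dense subspace of
`L²(P)`. -/
theorem topologicalClosure_span_neuron [CompactSpace X] (P : Measure X)
    [IsProbabilityMeasure P] {σ : ℝ → ℝ} (hσ : Continuous σ)
    (hpoly : ¬ ∃ p : Polynomial ℝ, ∀ z, σ z = p.eval z) :
    (Submodule.span ℝ (Set.range fun ω => ContinuousMap.toLp 2 P ℝ
      (neuronMap hσ X ω))).topologicalClosure = ⊤ := by
  rw [Submodule.topologicalClosure_eq_top_iff, Submodule.eq_bot_iff]
  intro h hh
  have hint : Integrable h P := (Lp.memLp h).integrable (by norm_num)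
  have horth : ∀ ω, ∫ x, h x * neuron σ X x ω ∂P = 0 := fun ω => by
    have := Submodule.inner_right_of_mem_orthogonal
      (Submodule.subset_span (Set.mem_range_self ω)) hh
    rw [L2.inner_def] at this
    rw [← this]
    refine integral_congr_ae ?_
    filter_upwards [ContinuousMap.coeFn_toLp (p := 2) (𝕜 := ℝ) P (neuronMap hσ X ω)] with x hx
    rw [hx]
    simp [neuronMap_apply]
  refine eq_zero_of_integral_mul_expRidge_eq_zero P h fun w => ?_
  have hu : Continuous fun x : X => inner ℝ w (x : EuclideanSpace ℝ (Fin d)) := by fun_prop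
  refine integral_mul_exp_eq_zero hint hu (integral_mul_pow_eq_zero hint hu hσ hpoly fun s b => ?_)
  -- The parameter `ω = (s w, b)` turns the neuron into `σ(s (w · x) + b)`.
  rw [← horth (WithLp.toLp 2 (Fin.snoc (fun i => s * w i) b))]
  simp only [neuron, inner_snoc_augment]

end Density

/-! ### Approximation by random samples -/

section Sampling

variable {Ω : Type*} [MeasurableSpace Ω] (μ : Measure Ω) [IsProbabilityMeasure μ]

/-- Enough independent samples hit each of finitely many given sets of positive measure, with
probability as close to `1` as desired. -/
theorem exists_sample_hits {m : ℕ} (U : Fin m → Set Ω) (hU : ∀ j, MeasurableSet (U j))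
    (hpos : ∀ j, 0 < μ (U j)) {δ : ℝ} (hδ : 0 < δ) :
    ∃ N : ℕ, 0 < N ∧ 1 - δ < (Measure.pi fun _ : Fin N => μ).real {ω | ∀ j, ∃ i, ω i ∈ U j} := by
  -- This is the union bound for the failure probability: by independence, all `N` samples miss `U
  -- j` with probability `(1 - μ(U j)) ^ N`.
  have hlim : Tendsto (fun N : ℕ => ∑ j, μ.real (U j)ᶜ ^ N) atTop (𝓝 0) := by
    rw [← Finset.sum_const_zero (s := (Finset.univ : Finset (Fin m)))]
    refine tendsto_finsetSum _ fun j _ =>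
      tendsto_pow_atTop_nhds_zero_of_lt_one measureReal_nonneg ?_
    rw [probReal_compl_eq_one_sub (hU j)]
    have : 0 < μ.real (U j) := ENNReal.toReal_pos (hpos j).ne' (measure_ne_top _ _)
    linarith
  obtain ⟨N, hN, hN0⟩ := ((hlim.eventually_lt_const hδ).and (eventually_gt_atTop 0)).exists
  refine ⟨N, hN0, ?_⟩
  have hmeas : MeasurableSet {ω : Fin N → Ω | ∀ j, ∃ i, ω i ∈ U j} := by
    simp only [Set.ofPred_forall, Set.ofPred_exists]
    exact .iInter fun j => .iUnion fun i => measurable_pi_apply i (hU j)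
  have hcompl : {ω : Fin N → Ω | ∀ j, ∃ i, ω i ∈ U j}ᶜ
      = ⋃ j, Set.univ.pi fun _ : Fin N => (U j)ᶜ := by
    ext ω
    simp
  have hle : (Measure.pi fun _ : Fin N => μ).real {ω | ∀ j, ∃ i, ω i ∈ U j}ᶜ
      ≤ ∑ j, μ.real (U j)ᶜ ^ N := by
    rw [hcompl]
    refine (measureReal_iUnion_fintype_le _).trans (Finset.sum_le_sum fun j _ => ?_)
    rw [measureReal_def, Measure.pi_pi]
    simp [measureReal_def]
  rw [probReal_compl_eq_one_sub hmeas] at hle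
  linarith

/-- A point of the dense span of a continuous family is approximated by the span of enough
independent samples. -/
theorem exists_sample_norm_lt [TopologicalSpace Ω] [OpensMeasurableSpace Ω] [μ.IsOpenPosMeasure]
    {E : Type*} [NormedAddCommGroup E] [NormedSpace ℝ E] {Φ : Ω → E} (hΦ : Continuous Φ)
    (hdense : (Submodule.span ℝ (Set.range Φ)).topologicalClosure = ⊤) (v : E) {δ ε : ℝ}
    (hδ : 0 < δ) (hε : 0 < ε) :
    ∃ N : ℕ, 0 < N ∧ 1 - δ < (Measure.pi fun _ : Fin N => μ).real
      {ω | ∃ c : Fin N → ℝ, ‖∑ i, c i • Φ (ω i) - v‖ < ε} := by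
  have hv : v ∈ closure (Submodule.span ℝ (Set.range Φ) : Set E) := by
    rw [← Submodule.topologicalClosure_coe, hdense]; trivial
  obtain ⟨s, hs, hsv⟩ := Metric.mem_closure_iff.1 hv ε hε
  obtain ⟨m, a, g, rfl⟩ := Submodule.mem_span_set'.1 hs
  choose p hp using fun j => (g j).2
  have hopen : IsOpen {ω : Fin m → Ω | ‖∑ j, a j • Φ (ω j) - v‖ < ε} :=
    isOpen_lt (by fun_prop) continuous_const
  have hmem : p ∈ {ω : Fin m → Ω | ‖∑ j, a j • Φ (ω j) - v‖ < ε} := by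
    simpa [hp, dist_eq_norm, norm_sub_rev] using hsv
  obtain ⟨U, hU, hsub⟩ := isOpen_pi_iff'.1 hopen p hmem
  obtain ⟨N, hN, hlt⟩ := exists_sample_hits μ U (fun j => (hU j).1.measurableSet)
    (fun j => (hU j).1.measure_pos μ ⟨p j, (hU j).2⟩) hδ
  refine ⟨N, hN, hlt.trans_le (measureReal_mono fun ω hω => ?_)⟩
  choose i hi using hω
  -- One sample may serve several of the sets, so it receives the sum of their coefficients; samples
  -- not chosen receive `0`.
  refine ⟨fun l => ∑ j with i j = l, a j, ?_⟩
  have hsum : ∑ l, (∑ j with i j = l, a j) • Φ (ω l) = ∑ j, a j • Φ (ω (i j)) := by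
    rw [← Finset.sum_fiberwise (s := Finset.univ) (g := i)]
    refine Finset.sum_congr rfl fun l _ => ?_
    rw [Finset.sum_smul]
    refine Finset.sum_congr rfl fun j hj => ?_
    rw [(Finset.mem_filter.1 hj).2]
  rw [hsum]
  exact hsub (a := fun j => ω (i j)) fun j _ => hi j

end Sampling

theorem isOpenPosMeasure_of_dense_support {Ω : Type*} [TopologicalSpace Ω] [MeasurableSpace Ω]
    {μ : Measure Ω} (h : Dense μ.support) : μ.IsOpenPosMeasure where
  open_pos U hU hne := by
    obtain ⟨x, hxU, hx⟩ := h.inter_open_nonempty U hU hne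
    exact ((Measure.mem_support_iff_forall x).1 hx U (hU.mem_nhds hxU)).ne'

end RandomFeature

/-! ### Universality of the random feature -/

theorem corollary1 {d : ℕ} (X : Set (EuclideanSpace ℝ (Fin d))) (r : ℝ)
    (hX : IsClosed X) (hXr : X ⊆ Metric.closedBall 0 r)
    (P : Measure X) [IsProbabilityMeasure P]
    (σ : ℝ → ℝ) (hσ : Continuous σ)
    (K M : ℝ) (k : ℕ) (hK : 0 ≤ K) (hM : 0 ≤ M)
    (hgrowth : ∀ z, |σ z| ≤ K * |z| ^ k + M)
    (μ : Measure (EuclideanSpace ℝ (Fin (d + 1)))) [IsProbabilityMeasure μ]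
    (hsupp : Dense μ.support)
    (M₂ : ℝ) (hmom : Integrable (fun ω => ‖ω‖ ^ (2 * k)) μ) (hM₂ : ∫ ω, ‖ω‖ ^ (2 * k) ∂μ ≤ M₂)
    (hpoly : ¬ ∃ p : Polynomial ℝ, ∀ z, σ z = p.eval z)
    (hadm : RandomFeature.IsAdmissible (RandomFeature.neuron σ X) μ P
      (RandomFeature.memLp_neuron hσ hX hXr P)
      (RandomFeature.memLp_kernel hσ hgrowth hXr hmom P)) :
    RandomFeature.IsUniversal (RandomFeature.neuron σ X) μ P := by
  have : CompactSpace X := isCompact_iff_compactSpace.1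
    ((isCompact_closedBall 0 r).of_isClosed_subset hX hXr)
  have := RandomFeature.isOpenPosMeasure_of_dense_support hsupp
  intro f δ hδ ε hε
  obtain ⟨N, hN, hlt⟩ := RandomFeature.exists_sample_norm_lt μ
    (Φ := fun ω => ContinuousMap.toLp 2 P ℝ (RandomFeature.neuronMap hσ X ω))
    ((ContinuousMap.toLp 2 P ℝ).continuous.comp (RandomFeature.neuronMap hσ X).continuous)
    (RandomFeature.topologicalClosure_span_neuron P hσ hpoly) (ContinuousMap.toLp 2 P ℝ f) hδ hε
  refine ⟨N, hN, hlt.trans_le (measureReal_mono fun ω hω => ?_)⟩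
  obtain ⟨c, hc⟩ := hω
  refine ⟨c, ?_⟩
  -- Linearity moves the combination into `C(X)`, so that the `L²` class has an explicit pointwise
  -- representative.
  have heq : ∑ i, c i • ContinuousMap.toLp 2 P ℝ (RandomFeature.neuronMap hσ X (ω i))
      - ContinuousMap.toLp 2 P ℝ f
      = ContinuousMap.toLp 2 P ℝ (∑ i, c i • RandomFeature.neuronMap hσ X (ω i) - f) := by
    simp
  rw [heq, ← ENNReal.ofReal_lt_ofReal_iff hε, ofReal_norm, Lp.enorm_def,
    eLpNorm_congr_ae (ContinuousMap.coeFn_toLp P _)] at hc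
  convert! hc using 3 with x
  simp [RandomFeature.neuronMap_apply]
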